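/- A topological space $G$ is \emph{rectifiable} if there are a homeomorphism $\varphi$ of $G\times G$ onto itself and a point $e\in G$ such that $\pi_1\circ\varphi=\pi_1$, where $\pi_1:G\times G\to G$ is the projection to the first coordinate, and $\varphi(x,x)=(x,e)$ for every $x\in G$. It is \emph{suborderable} (a \emph{GO-space}) if it is homeomorphic to a subspace of a linearly ordered set endowed with its order (open-interval) topology. It is a \emph{P-space} if every $G_\delta$-subset of $G$ is open, and it is \emph{totally disconnected} if every connected component is a single point. Theorem. Let $G$ be a suborderable space (a GO-space). If $G$ is rectifiable, then $G$ is metrizable or $G$ is a totally disconnected P-space. -/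

import Mathlib

universe u v

/-- A topological space `G` is rectifiable if there are a homeomorphism `φ` of `G × G` onto itself
and a point `e` of `G` such that `π₁ ∘ φ = π₁` and `φ (x, x) = (x, e)` for every `x`. -/
def IsRectifiable (G : Type u) [TopologicalSpace G] : Prop :=
  ∃ (φ : (G × G) ≃ₜ (G × G)) (e : G),
    (∀ z : G × G, (φ z).1 = z.1) ∧ ∀ x : G, φ (x, x) = (x, e)

/-- A topological space `X` is suborderable (a GO-space) if it is homeomorphic to a subspace of a
linearly ordered topological space `Y`, that is, of a linearly ordered set with its open-interval
topology. The linear order of `X` is then the one induced by `Y`. -/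
def IsSuborderable (X : Type u) [TopologicalSpace X] : Prop :=
  ∃ (Y : Type v) (_ : LinearOrder Y) (_ : TopologicalSpace Y) (_ : OrderTopology Y) (f : X → Y),
    Topology.IsEmbedding f

/-- A topological space is a P-space if each of its `Gδ`-subsets is open. -/
def IsPSpace (X : Type u) [TopologicalSpace X] : Prop :=
  ∀ s : Set X, IsGδ s → IsOpen s

/-!
Write the rectification as `φ (x, y) = (x, p x y)` with inverse `(x, y) ↦ (x, q x y)`. Each `p x` is
a homeomorphism taking `x` to `e`, so only the neighbourhood filter of `e` matters.

In a GO-space each of the two one-sided neighbourhood filters of `e` has a basis that is a chain, so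
it is either countably generated or closed under countable intersections. A genuinely mixed
situation does not occur. If points `x n ≠ e` converge to `e` from one side, then the maps
`q e ∘ p (x n)` move `e` and converge pointwise to the identity, which forces `e` to be isolated from
any side whose filter is closed under countable intersections
(`comap_nhdsGT_eq_bot_of_tendsto_id`). Therefore `e` has a countable neighbourhood base or is a
P-point (`nhds_isCountablyGenerated_or_countableInterFilter`).

In the first case Gul'ko's theorem applies (`metrizableSpace_of_rectification`): from a countable
base `U n` at `e` one gets symmetric open neighbourhoods `{(x, y) | p x y ∈ U n ∧ p y x ∈ U n}` of the
diagonal, which form a local uniformity. A countable local uniformity can be refined to a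
countably generated uniformity by repeated halving (`exists_isOpen_halving`).

In the second case every point is a P-point by homogeneity. A GO-space is completely regular, and in
a completely regular P-space the zero sets of continuous functions are clopen and separate points.
-/

open Set Filter Topology

/-! ### Countable local uniformities -/

/-- If the entourages `V n` satisfy the triangle inequality only locally, with a modulus depending
on the first point, then every open neighbourhood `W` of the diagonal can still be halved. The new
neighbourhood is a union of squares of the sections `V (m x)` at `x`. For two such squares that
meet, the one with the smaller index `m x` absorbs the other one. -/
theorem exists_isOpen_halving {X : Type*} [TopologicalSpace X] {V : ℕ → Set (X × X)}
    (hopen : ∀ n, IsOpen (V n)) (hanti : Antitone V)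
    (hrefl : ∀ n x, (x, x) ∈ V n) (hsymm : ∀ n x y, (x, y) ∈ V n → (y, x) ∈ V n)
    (hcomp : ∀ x n, ∃ m, ∀ y z, (x, y) ∈ V m → (y, z) ∈ V m → (x, z) ∈ V n)
    (hbasis : ∀ x, ∀ U ∈ 𝓝 x, ∃ n, ∀ y, (x, y) ∈ V n → y ∈ U)
    {W : Set (X × X)} (hW : IsOpen W) (hWrefl : ∀ x, (x, x) ∈ W) :
    ∃ W' : Set (X × X), IsOpen W' ∧ (∀ x, (x, x) ∈ W') ∧
      (∀ x y, (x, y) ∈ W' → (y, x) ∈ W') ∧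
      ∀ x y z, (x, y) ∈ W' → (y, z) ∈ W' → (x, z) ∈ W := by
  have key : ∀ x, ∃ n m, n ≤ m ∧ (∀ y z, (x, y) ∈ V n → (x, z) ∈ V n → (y, z) ∈ W) ∧
      ∀ a b c, (x, a) ∈ V m → (a, b) ∈ V m → (b, c) ∈ V m → (x, c) ∈ V n := by
    intro x
    obtain ⟨U₁, hU₁, U₂, hU₂, hU⟩ := mem_nhds_prod_iff.1 (hW.mem_nhds (hWrefl x))
    obtain ⟨n, hn⟩ := hbasis x _ (inter_mem hU₁ hU₂)
    obtain ⟨k, hk⟩ := hcomp x n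
    obtain ⟨m, hm⟩ := hcomp x k
    refine ⟨n, max n (max k m), le_max_left _ _,
      fun y z hy hz ↦ hU ⟨(hn y hy).1, (hn z hz).2⟩, fun a b c ha hb hc ↦ ?_⟩
    have hkM : k ≤ max n (max k m) := (le_max_left _ _).trans (le_max_right _ _)
    have hmM : m ≤ max n (max k m) := (le_max_right _ _).trans (le_max_right _ _)
    exact hk b c (hm a b (hanti hmM ha) (hanti hmM hb)) (hanti hkM hc)
  choose n m hnm hsq hcube using key
  refine ⟨⋃ x, {p | (x, p.1) ∈ V (m x) ∧ (x, p.2) ∈ V (m x)}, ?_, ?_, ?_, ?_⟩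
  · exact isOpen_iUnion fun x ↦ ((hopen (m x)).preimage (by fun_prop)).inter
      ((hopen (m x)).preimage (by fun_prop))
  · exact fun x ↦ mem_iUnion.2 ⟨x, hrefl _ _, hrefl _ _⟩
  · intro x y hxy
    obtain ⟨a, h₁, h₂⟩ := mem_iUnion.1 hxy
    exact mem_iUnion.2 ⟨a, h₂, h₁⟩
  · intro x y z hxy hyz
    obtain ⟨a, hax, hay⟩ := mem_iUnion.1 hxy
    obtain ⟨b, hby, hbz⟩ := mem_iUnion.1 hyz
    simp only at hax hay hby hbz
    rcases le_total (m a) (m b) with hab | hab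
    · exact hsq a x z (hanti (hnm a) hax)
        (hcube a y b z hay (hsymm _ _ _ (hanti hab hby)) (hanti hab hbz))
    · exact hsq b x z (hcube b y a x hby (hsymm _ _ _ (hanti hab hay)) (hanti hab hax))
        (hanti (hnm b) hbz)

/-- A T₀ space with a countable local uniformity is metrizable. -/
theorem metrizableSpace_of_local_uniformity {X : Type*} [TopologicalSpace X] [T0Space X]
    {V : ℕ → Set (X × X)} (hopen : ∀ n, IsOpen (V n)) (hanti : Antitone V)
    (hrefl : ∀ n x, (x, x) ∈ V n) (hsymm : ∀ n x y, (x, y) ∈ V n → (y, x) ∈ V n)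
    (hcomp : ∀ x n, ∃ m, ∀ y z, (x, y) ∈ V m → (y, z) ∈ V m → (x, z) ∈ V n)
    (hbasis : ∀ x, ∀ U ∈ 𝓝 x, ∃ n, ∀ y, (x, y) ∈ V n → y ∈ U) :
    TopologicalSpace.MetrizableSpace X := by
  let S := {W : Set (X × X) // IsOpen W ∧ (∀ x, (x, x) ∈ W) ∧ ∀ x y, (x, y) ∈ W → (y, x) ∈ W}
  have step : ∀ (k : ℕ) (W : S), ∃ W' : S, W'.1 ⊆ V k ∧
      ∀ x y z, (x, y) ∈ W'.1 → (y, z) ∈ W'.1 → (x, z) ∈ W.1 := by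
    rintro k ⟨W, hW, hWr, -⟩
    obtain ⟨W', ho, hr, hs, hc⟩ :=
      exists_isOpen_halving hopen hanti hrefl hsymm hcomp hbasis hW hWr
    refine ⟨⟨W' ∩ V k, ho.inter (hopen k), fun x ↦ ⟨hr x, hrefl k x⟩,
      fun x y h ↦ ⟨hs x y h.1, hsymm k x y h.2⟩⟩, inter_subset_right,
      fun x y z h₁ h₂ ↦ hc x y z h₁.1 h₂.1⟩
  choose next hnextV hnext using step
  let W : ℕ → S := fun k ↦
    Nat.rec ⟨V 0, hopen 0, hrefl 0, hsymm 0⟩ (fun k A ↦ next (k + 1) A) k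
  have hWV : ∀ k, (W k).1 ⊆ V k := by
    rintro (_ | k)
    · exact subset_rfl
    · exact hnextV _ _
  have hWW : ∀ k x y z, (x, y) ∈ (W (k + 1)).1 → (y, z) ∈ (W (k + 1)).1 → (x, z) ∈ (W k).1 :=
    fun k ↦ hnext _ _
  have hWanti : Antitone fun k ↦ (W k).1 :=
    antitone_nat_of_succ_le fun k ⟨x, y⟩ h ↦ hWW k x y y h ((W (k + 1)).2.2.1 y)
  have hB : (⨅ k, 𝓟 (W k).1).HasAntitoneBasis fun k ↦ (W k).1 := .iInf_principal hWanti
  let core : UniformSpace.Core X :=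
    { uniformity := ⨅ k, 𝓟 (W k).1
      refl := hB.ge_iff.2 fun k _ ↦ by
        rintro ⟨x, y⟩ (rfl : x = y)
        exact (W k).2.2.1 x
      symm := (hB.tendsto_iff hB.toHasBasis).2 fun k _ ↦
        ⟨k, trivial, fun p hp ↦ (W k).2.2.2 p.1 p.2 hp⟩
      comp := by
        refine hB.ge_iff.2 fun k _ ↦ ?_
        refine mem_of_superset (mem_lift' (hB.mem (k + 1))) ?_
        rintro ⟨x, z⟩ ⟨y, h₁, h₂⟩
        exact hWW k x y z h₁ h₂ }
  have hnhds : ∀ x : X, 𝓝 x = comap (Prod.mk x) core.uniformity := by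
    intro x
    refine le_antisymm ?_ fun U hU ↦ ?_
    · exact (hB.comap (Prod.mk x)).ge_iff.2 fun k _ ↦
        ((W k).2.1.preimage (by fun_prop)).mem_nhds ((W k).2.2.1 x)
    · obtain ⟨k, hk⟩ := hbasis x U hU
      exact mem_of_superset (preimage_mem_comap (hB.mem k)) fun y hy ↦ hk y (hWV k hy)
  let _ : UniformSpace X :=
    { core with
      toTopologicalSpace := inferInstance
      nhds_eq_comap_uniformity := hnhds }
  have : (uniformity X).IsCountablyGenerated := hB.isCountablyGenerated
  exact UniformSpace.metrizableSpace

/-! ### One-sided neighbourhoods in linear orders -/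

/-- A filter with a basis that is a chain is either countably generated or closed under countable
intersections. -/
theorem isCountablyGenerated_or_countableInterFilter_of_chain {α ι : Type*} {l : Filter α}
    {p : ι → Prop} {s : ι → Set α} (hl : l.HasBasis p s)
    (hs : ∀ i j, p i → p j → s i ⊆ s j ∨ s j ⊆ s i) :
    l.IsCountablyGenerated ∨ CountableInterFilter l := by
  refine or_iff_not_imp_right.2 fun h ↦ ?_
  have : ∃ t : ℕ → Set α, (∀ n, t n ∈ l) ∧ (⋂ n, t n) ∉ l := by
    by_contra! H
    refine h ⟨fun S hS hSl ↦ ?_⟩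
    rcases S.eq_empty_or_nonempty with rfl | hne
    · simp
    obtain ⟨t, rfl⟩ := hS.exists_eq_range hne
    rw [sInter_range]
    exact H t fun n ↦ hSl _ ⟨n, rfl⟩
  obtain ⟨t, ht, htl⟩ := this
  choose i hi hit using fun n ↦ hl.mem_iff.1 (ht n)
  -- No basis set lies below all the `s (i n)`, so by the chain condition these sets form a basis.
  have hB : l.HasBasis (fun _ : ℕ ↦ True) fun n ↦ s (i n) := by
    refine ⟨fun u ↦ ⟨fun hu ↦ ?_, fun ⟨n, _, hn⟩ ↦ mem_of_superset (hl.mem_of_mem (hi n)) hn⟩⟩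
    obtain ⟨j, hj, hju⟩ := hl.mem_iff.1 hu
    by_contra! H
    refine htl (mem_of_superset (hl.mem_of_mem hj) (subset_iInter fun n ↦ ?_))
    refine ((hs j (i n) hj (hi n)).resolve_right fun hn ↦ ?_).trans (hit n)
    exact H n trivial (hn.trans hju)
  exact hB.isCountablyGenerated

theorem nhdsGT_isCountablyGenerated_or_countableInterFilter {Y : Type*} [LinearOrder Y]
    [TopologicalSpace Y] [OrderTopology Y] (a : Y) :
    (𝓝[>] a).IsCountablyGenerated ∨ CountableInterFilter (𝓝[>] a) := by
  by_cases h : ∃ b, a < b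
  · refine isCountablyGenerated_or_countableInterFilter_of_chain
      (nhdsGT_basis_of_exists_gt h) fun i j _ _ ↦ ?_
    exact (le_total i j).imp Ioo_subset_Ioo_right Ioo_subset_Ioo_right
  · have : Ioi a = ∅ := eq_empty_of_forall_notMem fun b hb ↦ h ⟨b, hb⟩
    rw [this, nhdsWithin_empty]
    exact .inr inferInstance

theorem nhdsLT_isCountablyGenerated_or_countableInterFilter {Y : Type*} [LinearOrder Y]
    [TopologicalSpace Y] [OrderTopology Y] (a : Y) :
    (𝓝[<] a).IsCountablyGenerated ∨ CountableInterFilter (𝓝[<] a) :=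
  nhdsGT_isCountablyGenerated_or_countableInterFilter (OrderDual.toDual a)

/-- Suppose continuous self-maps `g n` converge pointwise to the identity without fixing `a`. Then
the right-hand neighbourhoods of `a` cannot be closed under countable intersections, unless `a` is
isolated from the right: some interval `[a, c]` would miss every `g n a`, hence also every `g n w`
for one and the same `w` in its interior. -/
theorem comap_nhdsGT_eq_bot_of_tendsto_id {G Y : Type*} [TopologicalSpace G] [LinearOrder Y]
    [TopologicalSpace Y] [OrderTopology Y] {f : G → Y} (hf : IsEmbedding f) {a : G}
    {g : ℕ → G → G} (hg : ∀ n, Continuous (g n)) (hga : ∀ n, g n a ≠ a)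
    (hlim : ∀ w, Tendsto (fun n ↦ g n w) atTop (𝓝 w)) [CountableInterFilter (𝓝[>] f a)] :
    comap f (𝓝[>] f a) = ⊥ := by
  by_contra hbot
  have : NeBot (comap f (𝓝[>] f a)) := ⟨hbot⟩
  have hle : comap f (𝓝[>] f a) ≤ 𝓝 a := by
    rw [hf.nhds_eq_comap]
    exact comap_mono nhdsWithin_le_nhds
  have hgt : ∀ᶠ z in comap f (𝓝[>] f a), f a < f z :=
    tendsto_comap.eventually self_mem_nhdsWithin
  have hlt : ∀ c, f a < c → ∀ᶠ z in comap f (𝓝[>] f a), f z < c := fun c hc ↦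
    tendsto_comap.eventually (nhdsWithin_le_nhds (Iio_mem_nhds hc))
  have hmiss : ∀ᶠ z in comap f (𝓝[>] f a), ∀ n, f (g n a) ∉ Icc (f a) (f z) := by
    refine eventually_countable_forall.2 fun n ↦ ?_
    rcases lt_or_gt_of_ne (hf.injective.ne (hga n)) with h | h
    · exact .of_forall fun z hz ↦ hz.1.not_gt h
    · exact (hlt _ h).mono fun z hz hz' ↦ hz'.2.not_gt hz
  obtain ⟨z, hz, hzmiss⟩ := (hgt.and hmiss).exists
  have hclosed : IsClosed (f ⁻¹' Icc (f a) (f z)) := isClosed_Icc.preimage hf.continuous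
  have hw : ∀ᶠ w in comap f (𝓝[>] f a), ∀ n, g n w ∉ f ⁻¹' Icc (f a) (f z) :=
    eventually_countable_forall.2 fun n ↦
      hle ((hg n).continuousAt.preimage_mem_nhds (hclosed.isOpen_compl.mem_nhds (hzmiss n)))
  obtain ⟨w, haw, hwz, hw⟩ := (hgt.and ((hlt _ hz).and hw)).exists
  have hmem : f ⁻¹' Icc (f a) (f z) ∈ 𝓝 w :=
    hf.continuous.continuousAt.preimage_mem_nhds (Icc_mem_nhds haw hwz)
  obtain ⟨n, hn⟩ := ((hlim w).eventually hmem).exists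
  exact hw n hn

/-! ### Rectifiable spaces -/

/-- A rectification in coordinates: `φ (x, y) = (x, p x y)` and `φ⁻¹ (x, y) = (x, q x y)`. In a
topological group one may think of `p x y = x⁻¹ * y` and `q x y = x * y`. -/
theorem IsRectifiable.exists_operations {G : Type*} [TopologicalSpace G] (h : IsRectifiable G) :
    ∃ (p q : G → G → G) (e : G), Continuous (fun z : G × G ↦ p z.1 z.2) ∧
      Continuous (fun z : G × G ↦ q z.1 z.2) ∧ (∀ x y, q x (p x y) = y) ∧
      (∀ x y, p x (q x y) = y) ∧ ∀ x, p x x = e := by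
  obtain ⟨φ, e, h₁, he⟩ := h
  have h₂ : ∀ z, (φ.symm z).1 = z.1 := fun z ↦ by
    rw [← h₁ (φ.symm z), φ.apply_symm_apply]
  refine ⟨fun x y ↦ (φ (x, y)).2, fun x y ↦ (φ.symm (x, y)).2, e, φ.continuous.snd,
    φ.symm.continuous.snd, fun x y ↦ ?_, fun x y ↦ ?_, fun x ↦ by simp [he]⟩
  · have : (x, (φ (x, y)).2) = φ (x, y) := Prod.ext (h₁ (x, y)).symm rfl
    simp [this]
  · have : (x, (φ.symm (x, y)).2) = φ.symm (x, y) := Prod.ext (h₂ (x, y)).symm rfl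
    simp [this]

/-- Homogeneity at the level of neighbourhoods: `p x` carries the neighbourhoods of `x` to those of
the neutral element. -/
theorem nhds_eq_comap_of_rectification {G : Type*} [TopologicalSpace G] {p q : G → G → G} {e : G}
    (hp : Continuous fun z : G × G ↦ p z.1 z.2) (hq : Continuous fun z : G × G ↦ q z.1 z.2)
    (hqp : ∀ x y, q x (p x y) = y) (hpe : ∀ x, p x x = e) (x : G) :
    𝓝 x = comap (p x) (𝓝 e) := by
  have hpx : Continuous (p x) := hp.comp (by fun_prop : Continuous fun y : G ↦ (x, y))
  have hqx : Continuous (q x) := hq.comp (by fun_prop : Continuous fun y : G ↦ (x, y))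
  refine le_antisymm ?_ fun U hU ↦ ?_
  · rw [← hpe x]
    exact hpx.continuousAt.le_comap
  · have : q x ⁻¹' U ∈ 𝓝 e := by
      apply hqx.continuousAt
      rwa [← hpe x, hqp]
    exact ⟨_, this, fun y hy ↦ by simpa [hqp] using hy⟩

/-- Gul'ko's theorem: a rectifiable T₀ space with a countable neighbourhood base at one point, the
neutral element, is metrizable. -/
theorem metrizableSpace_of_rectification {G : Type*} [TopologicalSpace G] [T0Space G]
    {p q : G → G → G} {e : G}
    (hp : Continuous fun z : G × G ↦ p z.1 z.2) (hq : Continuous fun z : G × G ↦ q z.1 z.2)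
    (hqp : ∀ x y, q x (p x y) = y) (hpe : ∀ x, p x x = e) [(𝓝 e).IsCountablyGenerated] :
    TopologicalSpace.MetrizableSpace G := by
  obtain ⟨U, hU, hUb⟩ := (nhds_basis_opens e).exists_antitone_subbasis
  let V : ℕ → Set (G × G) := fun n ↦ {z | p z.1 z.2 ∈ U n ∧ p z.2 z.1 ∈ U n}
  have hopen : ∀ n, IsOpen (V n) := fun n ↦
    ((hU n).2.preimage hp).inter ((hU n).2.preimage (hp.comp continuous_swap))
  have hanti : Antitone V := fun m n hmn z hz ↦
    ⟨hUb.antitone hmn hz.1, hUb.antitone hmn hz.2⟩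
  have hrefl : ∀ n x, (x, x) ∈ V n := fun n x ↦ by simp [V, hpe, (hU n).1]
  have hbasis : ∀ x, ∀ A ∈ 𝓝 x, ∃ n, ∀ y, (x, y) ∈ V n → y ∈ A := by
    intro x A hA
    rw [nhds_eq_comap_of_rectification hp hq hqp hpe x] at hA
    obtain ⟨n, hn⟩ := (hUb.comap (p x)).mem_iff.1 hA
    exact ⟨n, fun y hy ↦ hn hy.1⟩
  refine metrizableSpace_of_local_uniformity hopen hanti hrefl (fun n x y h ↦ h.symm) ?_ hbasis
  -- Since `z = q y (p y z)` and `q x e = x`, this is continuity of `q` at `(x, e)`.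
  intro x n
  have hx : {z | (x, z) ∈ V n} ∈ 𝓝 x :=
    ((hopen n).preimage (by fun_prop : Continuous fun z ↦ (x, z))).mem_nhds (hrefl n x)
  have hqx : q x e = x := by rw [← hpe x, hqp]
  have hpre : (fun z : G × G ↦ q z.1 z.2) ⁻¹' {z | (x, z) ∈ V n} ∈ 𝓝 (x, e) := by
    apply hq.continuousAt
    simpa only [hqx] using hx
  obtain ⟨A, hA, B, hB, hAB⟩ := mem_nhds_prod_iff.1 hpre
  obtain ⟨i, hi⟩ := hbasis x A hA
  obtain ⟨j, hj⟩ := hUb.mem_iff.1 hB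
  refine ⟨max i j, fun y z hy hz ↦ ?_⟩
  have hyz : (y, p y z) ∈ A ×ˢ B :=
    ⟨hi y (hanti (le_max_left _ _) hy), hj (hUb.antitone (le_max_right _ _) hz.1)⟩
  simpa [hqp] using hAB hyz

/-- In a rectifiable space a nontrivial sequence converging to `e` yields continuous self-maps
`q e ∘ p (x n)` that move `e` and converge pointwise to the identity. -/
theorem exists_seq_tendsto_id {G : Type*} [TopologicalSpace G] {p q : G → G → G} {e : G}
    (hp : Continuous fun z : G × G ↦ p z.1 z.2) (hq : Continuous fun z : G × G ↦ q z.1 z.2)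
    (hqp : ∀ x y, q x (p x y) = y) (hpq : ∀ x y, p x (q x y) = y) (hpe : ∀ x, p x x = e)
    {x : ℕ → G} (hx : Tendsto x atTop (𝓝 e)) (hxe : ∀ n, x n ≠ e) :
    ∃ g : ℕ → G → G, (∀ n, Continuous (g n)) ∧ (∀ n, g n e ≠ e) ∧
      ∀ w, Tendsto (fun n ↦ g n w) atTop (𝓝 w) := by
  have hqe : Continuous (q e) := hq.comp (by fun_prop : Continuous fun y : G ↦ (e, y))
  refine ⟨fun n y ↦ q e (p (x n) y), fun n ↦ ?_, fun n h ↦ ?_, fun w ↦ ?_⟩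
  · exact hqe.comp (hp.comp (by fun_prop : Continuous fun y : G ↦ (x n, y)))
  · have h₁ : p (x n) e = e := by
      rw [← hpq e (p (x n) e), show q e (p (x n) e) = e from h, hpe]
    have h₂ : q (x n) (p (x n) e) = q (x n) (p (x n) (x n)) := by rw [h₁, hpe]
    rw [hqp, hqp] at h₂
    exact hxe n h₂.symm
  · have hc : Continuous fun y : G ↦ q e (p y w) :=
      hqe.comp (hp.comp (by fun_prop : Continuous fun y : G ↦ (y, w)))
    have := (hc.tendsto e).comp hx
    rwa [hqp] at this

/-! ### Rectifiable GO-spaces and P-spaces -/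

/-- The neutral element of a rectifiable GO-space has a countable neighbourhood base or is a
P-point. A non-isolated side with a countable base supplies a sequence converging to `e`, and then
the other side cannot be of uncountable cofinality. -/
theorem nhds_isCountablyGenerated_or_countableInterFilter {G Y : Type*} [TopologicalSpace G]
    {p q : G → G → G} {e : G}
    (hp : Continuous fun z : G × G ↦ p z.1 z.2) (hq : Continuous fun z : G × G ↦ q z.1 z.2)
    (hqp : ∀ x y, q x (p x y) = y) (hpq : ∀ x y, p x (q x y) = y) (hpe : ∀ x, p x x = e)
    [LinearOrder Y] [TopologicalSpace Y] [OrderTopology Y] {f : G → Y} (hf : IsEmbedding f) :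
    (𝓝 e).IsCountablyGenerated ∨ CountableInterFilter (𝓝 e) := by
  have hsup : 𝓝 e = 𝓟 (f ⁻¹' {f e}) ⊔ (comap f (𝓝[<] f e) ⊔ comap f (𝓝[>] f e)) := by
    rw [hf.nhds_eq_comap, ← pure_sup_nhdsNE, ← nhdsLT_sup_nhdsGT, comap_sup, comap_sup,
      ← principal_singleton, comap_principal]
  have hseq : ∀ {s : Set Y}, f e ∉ s → (comap f (𝓝[s] f e)).IsCountablyGenerated →
      NeBot (comap f (𝓝[s] f e)) → ∃ g : ℕ → G → G, (∀ n, Continuous (g n)) ∧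
        (∀ n, g n e ≠ e) ∧ ∀ w, Tendsto (fun n ↦ g n w) atTop (𝓝 w) := by
    intro s hs _ _
    have hev : ∀ᶠ z in comap f (𝓝[s] f e), f z ∈ s :=
      tendsto_comap.eventually self_mem_nhdsWithin
    obtain ⟨x, hx, hxs⟩ := exists_seq_forall_of_frequently hev.frequently
    refine exists_seq_tendsto_id hp hq hqp hpq hpe (hx.mono_right ?_)
      fun n h ↦ hs (by simpa [h] using hxs n)
    rw [hf.nhds_eq_comap]
    exact comap_mono nhdsWithin_le_nhds
  rcases nhdsLT_isCountablyGenerated_or_countableInterFilter (f e) with hL | hL <;>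
    rcases nhdsGT_isCountablyGenerated_or_countableInterFilter (f e) with hR | hR
  · left
    rw [hsup]
    infer_instance
  · rcases (comap f (𝓝[<] f e)).eq_or_neBot with hbot | hne
    · right
      rw [hsup, hbot]
      infer_instance
    · obtain ⟨g, hg, hge, hlim⟩ := hseq (s := Iio (f e)) (lt_irrefl (f e)) inferInstance hne
      left
      rw [hsup, comap_nhdsGT_eq_bot_of_tendsto_id hf hg hge hlim]
      infer_instance
  · rcases (comap f (𝓝[>] f e)).eq_or_neBot with hbot | hne
    · right
      rw [hsup, hbot]
      infer_instance
    · obtain ⟨g, hg, hge, hlim⟩ := hseq (s := Ioi (f e)) (lt_irrefl (f e)) inferInstance hne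
      -- Reversing the order exchanges the two sides.
      have : CountableInterFilter (𝓝[>] (OrderDual.toDual ∘ f) e) := hL
      have hbot : comap f (𝓝[<] f e) = ⊥ :=
        comap_nhdsGT_eq_bot_of_tendsto_id (Y := Yᵒᵈ) (f := OrderDual.toDual ∘ f) hf hg hge hlim
      left
      rw [hsup, hbot]
      infer_instance
  · right
    rw [hsup]
    infer_instance

theorem isPSpace_of_countableInterFilter_nhds {X : Type*} [TopologicalSpace X]
    (h : ∀ x : X, CountableInterFilter (𝓝 x)) : IsPSpace X := by
  rintro s ⟨T, hT, hTc, rfl⟩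
  refine isOpen_iff_mem_nhds.2 fun x hx ↦ ?_
  have := h x
  exact (countable_sInter_mem hTc).2 fun t ht ↦ (hT t ht).mem_nhds (hx t ht)

/-- In a P-space the zero set of a real-valued continuous function is clopen. -/
theorem IsPSpace.totallyDisconnectedSpace {X : Type*} [TopologicalSpace X] [T1Space X]
    [CompletelyRegularSpace X] (h : IsPSpace X) : TotallyDisconnectedSpace X := by
  refine ⟨fun t _ ht x hx y hy ↦ ?_⟩
  by_contra hxy
  obtain ⟨f, hf, hfx, hfy⟩ := CompletelyRegularSpace.completely_regular x {y}
    isClosed_singleton hxy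
  have hz : IsClosed (f ⁻¹' {0}) := isClosed_singleton.preimage hf
  have hclopen : IsClopen (f ⁻¹' {0}) :=
    ⟨hz, h _ ((isClosed_singleton.isGδ).preimage hf)⟩
  have hy0 : f y = 0 := ht.subset_isClopen hclopen ⟨x, hx, hfx⟩ hy
  have hy1 : f y = 1 := hfy rfl
  exact zero_ne_one (hy0.symm.trans hy1)

theorem theorem3 (G : Type u) [TopologicalSpace G]
    (hrect : IsRectifiable G) (hsub : IsSuborderable.{u, v} G) :
    TopologicalSpace.MetrizableSpace G ∨ (TotallyDisconnectedSpace G ∧ IsPSpace G) := by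
  obtain ⟨p, q, e, hp, hq, hqp, hpq, hpe⟩ := hrect.exists_operations
  obtain ⟨Y, _, _, _, f, hf⟩ := hsub
  have : T2Space G := hf.t2Space
  have : CompletelyRegularSpace G := hf.isInducing.completelyRegularSpace
  rcases nhds_isCountablyGenerated_or_countableInterFilter hp hq hqp hpq hpe hf with h | h
  · exact .inl (metrizableSpace_of_rectification hp hq hqp hpe)
  · have hP : IsPSpace G := isPSpace_of_countableInterFilter_nhds fun x ↦ by
      rw [nhds_eq_comap_of_rectification hp hq hqp hpe x]
      infer_instance
    exact .inr ⟨hP.totallyDisconnectedSpace, hP⟩
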